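/- **Theorem (Simulating auxiliary inputs).** Circuits are Boolean circuits over the basis of constants, $\neg$, $\wedge$, $\vee$ with fan-in at most two, and their size is the number of gates. A circuit with values in $[0,1]$ is such a circuit whose output bits are read as the binary expansion $b_0.b_1b_2\ldots$ of a real number, which lies in $[0,1]$ for every input; circuits with one output bit are the Boolean ones. Two distributions $Y_1,Y_2$ on $\{0,1\}^m$ are $(s,\varepsilon)$-indistinguishable if $|\mathbb{E}A(Y_1)-\mathbb{E}A(Y_2)|\le\varepsilon$ for every circuit $A$ with values in $[0,1]$ of size at most $s$. A randomized circuit additionally receives a finite number of uniform random bits, which are independent of everything else. There is an absolute constant $C>0$ such that the following holds. Let $n,\lambda\ge 0$ be integers, let $X\in\{0,1\}^n$ and $Z\in\{0,1\}^\lambda$ be arbitrary (possibly correlated) random variables on a common probability space, let $s\ge 1$ be an integer and let $\varepsilon>0$. Then there is a randomized circuit $\mathsf{Sim}:\{0,1\}^n\to\{0,1\}^\lambda$ of size at most $$C\cdot s\cdot 2^{2\lambda}\,\varepsilon^{-4}$$ such that $(X,Z)$ and $(X,\mathsf{Sim}(X))$ are $(s,\varepsilon)$-indistinguishable. -/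

import Mathlib

open MeasureTheory

/-- A gate of a Boolean circuit whose incoming wires are taken from `W` (fan-in at most two). -/
inductive Gate (W : Type) : Type
  | const (b : Bool) : Gate W
  | not (i : W) : Gate W
  | and (i j : W) : Gate W
  | or (i j : W) : Gate W

/-- The Boolean value of a gate, given the values carried by the wires. -/
def Gate.eval {W : Type} (v : W → Bool) : Gate W → Bool
  | .const b => b
  | .not i => !(v i)
  | .and i j => v i && v j
  | .or i j => v i || v j

/-- A list of `k` gates in topological order: every gate reads input wires (indexed by `ι`)
and outputs of gates that come before it. -/
inductive Netlist (ι : Type) : ℕ → Type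
  | nil : Netlist ι 0
  | snoc {k : ℕ} (c : Netlist ι k) (g : Gate (ι ⊕ Fin k)) : Netlist ι (k + 1)

/-- The values of all wires (the input wires and the outputs of the gates) on the input `x`. -/
def Netlist.eval {ι : Type} (x : ι → Bool) : {k : ℕ} → Netlist ι k → ι ⊕ Fin k → Bool
  | _, .nil => Sum.elim x (fun i => i.elim0)
  | _, .snoc c g =>
      Sum.elim x
        (Fin.snoc (α := fun _ => Bool) (fun i => c.eval x (Sum.inr i)) (g.eval (c.eval x)))

/-- A Boolean circuit with input bits indexed by `ι` and output bits indexed by `κ`. Its size is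
the number of gates; every output bit is read off from an input wire or from a gate. -/
structure Circuit (ι κ : Type) : Type where
  size : ℕ
  gates : Netlist ι size
  out : κ → ι ⊕ Fin size

/-- The function `{0,1}^ι → {0,1}^κ` computed by a circuit. -/
def Circuit.eval {ι κ : Type} (c : Circuit ι κ) (x : ι → Bool) : κ → Bool :=
  fun j => c.gates.eval x (c.out j)

/-- The real number `b₀.b₁b₂…` (binary expansion) written by the output bits of a circuit. For a
circuit with a single output bit it is that bit, viewed as `0` or `1`. -/
noncomputable def Circuit.realEval {ι : Type} {p : ℕ} (c : Circuit ι (Fin p)) (x : ι → Bool) : ℝ :=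
  ∑ i : Fin p, (if c.eval x i then (1 : ℝ) else 0) / 2 ^ (i : ℕ)

/-- Two distributions on `{0,1}^ι` are `(s, ε)`-indistinguishable: every `[0,1]`-valued circuit of
size at most `s` (in particular every Boolean one) has advantage at most `ε`. -/
def Indistinguishable {ι : Type} (s : ℕ) (ε : ℝ) (μ ν : Measure (ι → Bool)) : Prop :=
  ∀ (p : ℕ) (A : Circuit ι (Fin p)), A.size ≤ s → (∀ x, A.realEval x ≤ 1) →
    |(∫ x, A.realEval x ∂μ) - ∫ x, A.realEval x ∂ν| ≤ ε

/-- The uniform distribution on strings of `r` random bits. -/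
noncomputable def coins (r : ℕ) : Measure (Fin r → Bool) :=
  (PMF.uniformOfFintype (Fin r → Bool)).toMeasure

/-! The simulator follows the perturbed leader. Fix a short list of tests. On input `x`, each string
`z` scores the number of tests accepting `(x, z)` plus independent truncated geometric noise of
parameter `η`, and the output is the first `z` of maximal score (`leader`).

A suitable list exists by a potential argument (`IsGeometric.exists_list`). As long as some test
accepts `(X, Z)` with probability more than `2δ` above the simulated pair, prepend it. The potential
is the mean of the expected top score (`leaderValue`) minus the score of the true `Z` without noise;
it is never negative. A new test raises the top score by at most the probability that the new leader
passes it. Memorylessness of the noise bounds this by the probability for the old leader plus `δ`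
(`IsGeometric.stability`), so the potential falls by more than `δ`. Initially it is the expected
maximum of `2 ^ l` noises, of order `(l + 1) / η`. With `η` and `δ` of order `ε`, the list has `T =
O((l + 1) / ε ^ 2)` tests.

With scores kept in unary and `N = 2 ^ l`, the leader costs `O(N * T ^ 2 + N * T * s + N ^ 2)`
gates, and `(l + 1) ^ 2 ≤ 4 * 2 ^ l` brings this to the stated size. -/

open scoped BigOperators

/-! ### Resampling one coordinate; first maxima -/

theorem expect_update {J R : Type*} [Fintype J] [DecidableEq J] [Fintype R] [Nonempty R]
    (z : J) (f : (J → R) → ℝ) :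
    𝔼 w, 𝔼 r, f (Function.update w z r) = 𝔼 w, f w := by
  -- Exchanging coordinate `z` with the fresh sample is an involution, so it preserves the uniform
  -- average.
  let e : (J → R) × R ≃ (J → R) × R :=
    { toFun := fun p => (Function.update p.1 z p.2, p.1 z)
      invFun := fun p => (Function.update p.1 z p.2, p.1 z)
      left_inv := fun p => by simp
      right_inv := fun p => by simp }
  have h1 : 𝔼 w, 𝔼 r, f (Function.update w z r) = 𝔼 p : (J → R) × R, f (e p).1 := by
    rw [← Finset.univ_product_univ, Finset.expect_product]
    rfl
  have h2 : 𝔼 p : (J → R) × R, f (e p).1 = 𝔼 p : (J → R) × R, f p.1 :=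
    Fintype.expect_equiv e _ _ fun _ => rfl
  rw [h1, h2, ← Finset.univ_product_univ, Finset.expect_product]
  simp

/-- `z` is the first index at which `c` is maximal. -/
def IsFirstMax {J : Type*} [LinearOrder J] (c : J → ℕ) (z : J) : Prop :=
  ∀ y, c y ≤ c z ∧ (y < z → c y < c z)

theorem exists_isFirstMax {J : Type*} [LinearOrder J] [Fintype J] [Nonempty J] (c : J → ℕ) :
    ∃ z, IsFirstMax c z := by
  classical
  obtain ⟨m, hm⟩ := Finite.exists_max c
  let S : Finset J := Finset.univ.filter fun z => c z = c m
  have hS : S.Nonempty := ⟨m, by simp [S]⟩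
  have h1 : c (S.min' hS) = c m := (Finset.mem_filter.1 (S.min'_mem hS)).2
  refine ⟨S.min' hS, fun y => ⟨h1 ▸ hm y, fun hy => ?_⟩⟩
  rw [h1]
  refine lt_of_le_of_ne (hm y) fun h => ?_
  exact absurd (S.min'_le y (by simp [S, h])) (not_le.2 hy)

/-- The first index at which `c` is maximal. -/
noncomputable def firstMax {J : Type*} [LinearOrder J] [Fintype J] [Nonempty J] (c : J → ℕ) : J :=
  (exists_isFirstMax c).choose

theorem isFirstMax_firstMax {J : Type*} [LinearOrder J] [Fintype J] [Nonempty J] (c : J → ℕ) :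
    IsFirstMax c (firstMax c) :=
  (exists_isFirstMax c).choose_spec

theorem IsFirstMax.eq {J : Type*} [LinearOrder J] {c : J → ℕ} {y z : J}
    (hy : IsFirstMax c y) (hz : IsFirstMax c z) : y = z := by
  rcases lt_trichotomy y z with h | h | h
  · exact absurd ((hz y).2 h) (not_lt.2 (hy z).1)
  · exact h
  · exact absurd ((hy z).2 h) (not_lt.2 (hz y).1)

theorem firstMax_eq_iff {J : Type*} [LinearOrder J] [Fintype J] [Nonempty J] (c : J → ℕ) (z : J) :
    firstMax c = z ↔ IsFirstMax c z :=
  ⟨fun h => h ▸ isFirstMax_firstMax c, fun h => (isFirstMax_firstMax c).eq h⟩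

/-! ### Truncated geometric noise -/

/-- `G` is a truncated geometric noise: `P(G ≥ k) = (1 - η)^k` for `k ≤ M`, and `G ≤ M`. -/
structure IsGeometric {R : Type*} [Fintype R] (G : R → ℕ) (η : ℝ) (M : ℕ) : Prop where
  le : ∀ r, G r ≤ M
  tail : ∀ k ≤ M, (Finset.univ.expect fun r => if k ≤ G r then (1 : ℝ) else 0) = (1 - η) ^ k

-- Memorylessness: an upward closed `D` is a threshold `v ≤ G`, and raising the threshold by one
-- multiplies its probability by `1 - η`. This fails only at the truncation point `v = M`, which the
-- additive term covers.
open Classical in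
theorem IsGeometric.shift {R : Type*} [Fintype R] {G : R → ℕ} {η : ℝ} {M : ℕ}
    (hG : IsGeometric G η M) (h0 : 0 ≤ η) (h1 : η ≤ 1) (D D' : ℕ → Prop)
    (hD : ∀ k m, k ≤ m → D k → D m) (hD' : ∀ k, D k → D' (k + 1)) :
    (1 - η) * (𝔼 r, if D (G r) then (1 : ℝ) else 0)
      ≤ (𝔼 r, if D' (G r) then (1 : ℝ) else 0) + (1 - η) ^ M := by
  have hnn : 0 ≤ 1 - η := by linarith
  have hD'0 : 0 ≤ 𝔼 r, if D' (G r) then (1 : ℝ) else 0 :=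
    Finset.expect_nonneg fun r _ => by split_ifs <;> norm_num
  by_cases hex : ∃ k, D k
  · let v := Nat.find hex
    have hv : ∀ k, D k ↔ v ≤ k :=
      fun k => ⟨fun h => Nat.find_min' hex h, fun h => hD _ _ h (Nat.find_spec hex)⟩
    have hle : (𝔼 r, if v + 1 ≤ G r then (1 : ℝ) else 0)
        ≤ 𝔼 r, if D' (G r) then (1 : ℝ) else 0 := by
      refine Finset.expect_le_expect fun r _ => ?_
      by_cases h : v + 1 ≤ G r
      · have : D' (G r) := by
          have := hD' (G r - 1) ((hv _).2 (by omega))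
          rwa [Nat.sub_add_cancel (by omega)] at this
        simp [h, this]
      · rw [if_neg h]; split_ifs <;> norm_num
    simp only [hv]
    rcases lt_trichotomy v M with h | h | h
    · rw [hG.tail v h.le]
      rw [hG.tail (v + 1) h, pow_succ] at hle
      have := pow_nonneg hnn M
      linarith
    · rw [hG.tail v h.le, h]
      have := mul_le_mul_of_nonneg_right (show 1 - η ≤ 1 by linarith) (pow_nonneg hnn M)
      linarith
    · have : ∀ r, ¬ v ≤ G r := fun r hr => absurd (hG.le r) (by omega)
      simp only [this, if_false, Finset.expect_const_zero, mul_zero]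
      have := pow_nonneg hnn M
      linarith
  · have : ∀ k, ¬ D k := fun k hk => hex ⟨k, hk⟩
    simp only [this, if_false, Finset.expect_const_zero, mul_zero]
    have := pow_nonneg hnn M
    linarith

/-- The excess over `k₀` is the sum of the indicators of `k₀ + i + 1 ≤ G`, whose expectations form a
geometric series. -/
theorem IsGeometric.expect_sub_le {R : Type*} [Fintype R] {G : R → ℕ} {η : ℝ} {M : ℕ}
    (hG : IsGeometric G η M) (h0 : 0 < η) (h1 : η ≤ 1) (k₀ : ℕ) :
    (𝔼 r, ((G r - k₀ : ℕ) : ℝ)) ≤ (1 - η) ^ k₀ / η := by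
  have hnn : 0 ≤ 1 - η := by linarith
  have e : ∀ r, ((G r - k₀ : ℕ) : ℝ)
      = ∑ i ∈ Finset.range (M - k₀), if k₀ + i + 1 ≤ G r then (1 : ℝ) else 0 := by
    intro r
    rw [Finset.sum_boole]
    congr 1
    have : (Finset.range (M - k₀)).filter (fun i => k₀ + i + 1 ≤ G r)
        = Finset.range (G r - k₀) := by
      ext i
      have := hG.le r
      simp only [Finset.mem_filter, Finset.mem_range]
      omega
    rw [this, Finset.card_range]
  simp only [e]
  rw [Finset.expect_sum_comm]
  have e2 : ∀ i ∈ Finset.range (M - k₀),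
      (𝔼 r, if k₀ + i + 1 ≤ G r then (1 : ℝ) else 0) = (1 - η) ^ (k₀ + 1) * (1 - η) ^ i := by
    intro i hi
    rw [Finset.mem_range] at hi
    rw [hG.tail _ (by omega), ← pow_add]
    congr 1
    omega
  rw [Finset.sum_congr rfl e2, ← Finset.mul_sum]
  have hs : (∑ i ∈ Finset.range (M - k₀), (1 - η) ^ i) * η ≤ 1 := by
    have := geom_sum_mul_neg (1 - η) (M - k₀)
    have h2 := pow_nonneg hnn (M - k₀)
    rw [show (1 - (1 - η)) = η by ring] at this
    linarith
  rw [le_div_iff₀ h0, mul_assoc, pow_succ]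
  have h3 := pow_nonneg hnn k₀
  have h4 : 0 ≤ (∑ i ∈ Finset.range (M - k₀), (1 - η) ^ i) * η :=
    mul_nonneg (Finset.sum_nonneg fun i _ => pow_nonneg hnn i) h0.le
  calc (1 - η) ^ k₀ * (1 - η) * ((∑ i ∈ Finset.range (M - k₀), (1 - η) ^ i) * η)
      ≤ (1 - η) ^ k₀ * 1 * 1 := by gcongr; linarith
    _ = _ := by ring

/-! ### Stability and value of the perturbed leader -/

/-- The values `c z` perturbed by the noise. -/
def perturb {J R : Type*} (G : R → ℕ) (w : J → R) (c : J → ℕ) (z : J) : ℕ := G (w z) + c z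

section
variable {J R : Type*} [LinearOrder J] [Fintype J] [Nonempty J] [Fintype R] [Nonempty R]
  {G : R → ℕ} {η : ℝ} {M : ℕ}

-- Freeze all noise except that of `z`; then `z` leads exactly when its own noise is large enough.
-- Since `a z` is true, the update lifts `z` by one and no rival by more, so one extra unit of noise
-- at `z` makes up for its absence.
open Classical in
theorem IsGeometric.prob_firstMax_le (hG : IsGeometric G η M) (h0 : 0 ≤ η) (h1 : η ≤ 1)
    (c : J → ℕ) (a : J → Bool) (z : J) (ha : a z = true) :
    (1 - η) * (𝔼 w : J → R,
        if firstMax (perturb G w fun y => c y + (a y).toNat) = z then (1 : ℝ) else 0)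
      ≤ (𝔼 w : J → R, if firstMax (perturb G w c) = z then (1 : ℝ) else 0) + (1 - η) ^ M := by
  rw [← expect_update z,
    ← expect_update z (fun w => if firstMax (perturb G w c) = z then (1:ℝ) else 0),
    Finset.mul_expect]
  have hconst : (1 - η) ^ M = 𝔼 _w : J → R, (1 - η) ^ M := by simp
  rw [hconst, ← Finset.expect_add_distrib]
  refine Finset.expect_le_expect fun w _ => ?_
  -- `D` and `D'` say that noise `k` at `z` makes it the leader after and before the update,
  -- respectively.
  obtain ⟨D, hD⟩ : ∃ D : ℕ → Prop, ∀ k, D k ↔ ∀ y ≠ z,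
      G (w y) + c y + (a y).toNat ≤ k + c z + 1 ∧
        (y < z → G (w y) + c y + (a y).toNat < k + c z + 1) := ⟨_, fun _ => Iff.rfl⟩
  obtain ⟨D', hD'⟩ : ∃ D' : ℕ → Prop, ∀ k, D' k ↔ ∀ y ≠ z, G (w y) + c y ≤ k + c z ∧
      (y < z → G (w y) + c y < k + c z) := ⟨_, fun _ => Iff.rfl⟩
  have e1 : ∀ r, firstMax (perturb G (Function.update w z r) fun y => c y + (a y).toNat) = z
      ↔ D (G r) := by
    intro r
    rw [firstMax_eq_iff, hD]
    constructor
    · intro h y hy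
      have := h y
      simp only [perturb, Function.update_of_ne hy, Function.update_self, ha, Bool.toNat_true] at this
      simpa only [add_assoc] using this
    · intro h y
      by_cases hy : y = z
      · subst hy; simp
      · have := h y hy
        simp only [perturb, Function.update_of_ne hy, Function.update_self, ha, Bool.toNat_true]
        simpa only [add_assoc] using this
  have e2 : ∀ r, firstMax (perturb G (Function.update w z r) c) = z ↔ D' (G r) := by
    intro r
    rw [firstMax_eq_iff, hD']
    constructor
    · intro h y hy
      have := h y
      simpa only [perturb, Function.update_of_ne hy, Function.update_self] using this
    · intro h y
      by_cases hy : y = z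
      · subst hy; simp
      · have := h y hy
        simpa only [perturb, Function.update_of_ne hy, Function.update_self] using this
  simp only [e1, e2]
  refine hG.shift h0 h1 D D' (fun k m hkm h => ?_) (fun k h => ?_)
  · rw [hD] at h ⊢
    intro y hy
    have := h y hy
    exact ⟨by omega, fun hlt => by have := this.2 hlt; omega⟩
  · rw [hD] at h
    rw [hD']
    intro y hy
    have := h y hy
    exact ⟨by omega, fun hlt => by have := this.2 hlt; omega⟩

theorem toNat_firstMax_eq_sum (a : J → Bool) (c : J → ℕ) :
    ((a (firstMax c)).toNat : ℝ)
      = ∑ z ∈ Finset.univ.filter (fun z => a z = true), if firstMax c = z then (1 : ℝ) else 0 := by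
  rw [Finset.sum_ite_eq]
  cases h : a (firstMax c) <;> simp [h]

/-- The perturbed leader is stable under adding one more gain vector `a`. -/
theorem IsGeometric.stability (hG : IsGeometric G η M) (h0 : 0 ≤ η) (h1 : η ≤ 1)
    (c : J → ℕ) (a : J → Bool) :
    (𝔼 w : J → R, ((a (firstMax (perturb G w fun y => c y + (a y).toNat))).toNat : ℝ))
      ≤ (𝔼 w : J → R, ((a (firstMax (perturb G w c))).toNat : ℝ))
        + (η + Fintype.card J * (1 - η) ^ M) := by
  have hnn : 0 ≤ 1 - η := by linarith
  set E' := 𝔼 w : J → R, ((a (firstMax (perturb G w fun y => c y + (a y).toNat))).toNat : ℝ)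
    with hE'
  have hE1 : E' ≤ 1 := by
    refine Finset.expect_le Finset.univ_nonempty fun w _ => ?_
    cases a (firstMax (perturb G w fun y => c y + (a y).toNat)) <;> simp
  have key : (1 - η) * E' ≤ (𝔼 w : J → R, ((a (firstMax (perturb G w c))).toNat : ℝ))
      + Fintype.card J * (1 - η) ^ M := by
    rw [hE']
    simp only [toNat_firstMax_eq_sum a]
    rw [Finset.expect_sum_comm, Finset.expect_sum_comm, Finset.mul_sum]
    calc _ ≤ ∑ z ∈ Finset.univ.filter (fun z => a z = true),
          ((𝔼 w : J → R, if firstMax (perturb G w c) = z then (1 : ℝ) else 0) + (1 - η) ^ M) := by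
          refine Finset.sum_le_sum fun z hz => ?_
          have := hG.prob_firstMax_le h0 h1 c a z (Finset.mem_filter.1 hz).2
          convert this
      _ ≤ _ := by
          rw [Finset.sum_add_distrib, Finset.sum_const, nsmul_eq_mul]
          gcongr
          exact Finset.card_le_univ _
  -- As `E' ≤ 1`, the factor `1 - η` costs at most an additive `η`.
  nlinarith

/-- The expected value of the perturbed leader. -/
noncomputable def leaderValue (G : R → ℕ) (c : J → ℕ) : ℝ :=
  𝔼 w : J → R, (perturb G w c (firstMax (perturb G w c)) : ℝ)

theorem le_leaderValue (G : R → ℕ) (c : J → ℕ) (z : J) : (c z : ℝ) ≤ leaderValue G c := by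
  refine Finset.le_expect Finset.univ_nonempty fun w _ => ?_
  have := (isFirstMax_firstMax (perturb G w c) z).1
  exact_mod_cast le_trans (Nat.le_add_left _ _) this

/-- For fixed noise, the new leader `z` had old score at most the old maximum, so the maximum grows
by at most `a z`. Stability then replaces the new leader by the old one. -/
theorem IsGeometric.leaderValue_add_le (hG : IsGeometric G η M) (h0 : 0 ≤ η) (h1 : η ≤ 1)
    (c : J → ℕ) (a : J → Bool) :
    leaderValue G (fun y => c y + (a y).toNat)
      ≤ leaderValue G c + (𝔼 w : J → R, ((a (firstMax (perturb G w c))).toNat : ℝ))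
        + (η + Fintype.card J * (1 - η) ^ M) := by
  have := hG.stability h0 h1 c a
  suffices h : leaderValue G (fun y => c y + (a y).toNat) ≤ leaderValue G c +
      𝔼 w : J → R, ((a (firstMax (perturb G w fun y => c y + (a y).toNat))).toNat : ℝ) by linarith
  rw [leaderValue, leaderValue, ← Finset.expect_add_distrib]
  refine Finset.expect_le_expect fun w _ => ?_
  set z := firstMax (perturb G w fun y => c y + (a y).toNat)
  have := (isFirstMax_firstMax (perturb G w c) z).1
  simp only [perturb] at this ⊢
  norm_cast
  omega

/-- A maximum of noises is at most `k₀` plus the sum of all their excesses over `k₀`. -/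
theorem IsGeometric.leaderValue_zero_le (hG : IsGeometric G η M) (h0 : 0 < η) (h1 : η ≤ 1)
    (k₀ : ℕ) :
    leaderValue (J := J) G (fun _ => 0) ≤ k₀ + Fintype.card J * ((1 - η) ^ k₀ / η) := by
  have hz : ∀ z : J, (𝔼 w : J → R, ((G (w z) - k₀ : ℕ) : ℝ)) ≤ (1 - η) ^ k₀ / η := by
    intro z
    rw [← expect_update z]
    simpa using hG.expect_sub_le h0 h1 k₀
  calc leaderValue (J := J) G (fun _ => 0)
      ≤ 𝔼 w : J → R, ((k₀ : ℝ) + ∑ z, ((G (w z) - k₀ : ℕ) : ℝ)) := by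
        refine Finset.expect_le_expect fun w _ => ?_
        set z := firstMax (perturb G w fun _ => 0)
        have : ((G (w z) - k₀ : ℕ) : ℝ) ≤ ∑ z, ((G (w z) - k₀ : ℕ) : ℝ) :=
          Finset.single_le_sum (f := fun z => ((G (w z) - k₀ : ℕ) : ℝ))
            (fun z _ => Nat.cast_nonneg _) (Finset.mem_univ z)
        refine le_trans ?_ (add_le_add_right this _)
        simp only [perturb]
        norm_cast
        omega
    _ = k₀ + ∑ z : J, 𝔼 w : J → R, ((G (w z) - k₀ : ℕ) : ℝ) := by
        rw [Finset.expect_add_distrib, Finset.expect_sum_comm]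
        simp
    _ ≤ _ := by
        gcongr
        calc _ ≤ ∑ z : J, (1 - η) ^ k₀ / η := Finset.sum_le_sum fun z _ => hz z
          _ = _ := by simp

/-! ### The potential argument -/

/-- The number of tests in `L` that accept `(x, z)`. -/
def hits {α J : Type*} (L : List (α → J → Bool)) (x : α) (z : J) : ℕ :=
  L.countP fun a => a x z

theorem hits_cons {α J : Type*} (a : α → J → Bool) (L : List (α → J → Bool)) (x : α) :
    hits (a :: L) x = fun z => hits L x z + (a x z).toNat := by
  ext z
  simp only [hits, List.countP_cons]
  cases a x z <;> simp

/-- The value sampled by the perturbed leader for the tests in `L`. -/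
noncomputable def leader {α : Type*} (G : R → ℕ) (L : List (α → J → Bool)) (x : α)
    (w : J → R) : J :=
  firstMax (perturb G w (hits L x))

/-- A short list of tests suffices for the perturbed leader to fool a whole class of tests. -/
theorem IsGeometric.exists_list {α : Type*} [Fintype α] (hG : IsGeometric G η M) (h0 : 0 < η)
    (h1 : η ≤ 1) (p : α → J → ℝ) (hp : ∀ x z, 0 ≤ p x z) (hp1 : ∑ x, ∑ z, p x z = 1)
    (𝒜 : Set (α → J → Bool)) (δ : ℝ) (k₀ T : ℕ)
    (hδ : η + Fintype.card J * (1 - η) ^ M ≤ δ)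
    (hT : k₀ + Fintype.card J * ((1 - η) ^ k₀ / η) < T * δ) :
    ∃ L : List (α → J → Bool), L.length ≤ T ∧ (∀ a ∈ L, a ∈ 𝒜) ∧ ∀ a ∈ 𝒜,
      ∑ x, ∑ z, p x z * ((a x z).toNat - 𝔼 w : J → R, ((a x (leader G L x w)).toNat : ℝ))
        ≤ 2 * δ := by
  by_contra! hcon
  -- The potential: the regret of the pair drawn from `p` against the perturbed leader.
  let Ψ : List (α → J → Bool) → ℝ := fun L =>
    ∑ x, ∑ z, p x z * (leaderValue G (hits L x) - hits L x z)
  have hΨ0 : ∀ L, 0 ≤ Ψ L := fun L => Finset.sum_nonneg fun x _ => Finset.sum_nonneg fun z _ =>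
    mul_nonneg (hp x z) (sub_nonneg.2 (le_leaderValue G _ z))
  have hΨnil : Ψ [] ≤ T * δ := by
    refine le_trans ?_ hT.le
    have : ∀ x : α, hits ([] : List (α → J → Bool)) x = fun _ => 0 := fun x => by ext; simp [hits]
    simp only [Ψ, this, Nat.cast_zero, sub_zero]
    simp only [← Finset.sum_mul, hp1, one_mul]
    exact hG.leaderValue_zero_le h0 h1 k₀
  have step : ∀ t ≤ T + 1, ∃ L : List (α → J → Bool), L.length = t ∧ (∀ a ∈ L, a ∈ 𝒜) ∧
      Ψ L ≤ Ψ [] - t * δ := by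
    intro t
    induction t with
    | zero => exact fun _ => ⟨[], rfl, by simp, by simp⟩
    | succ t ih =>
      intro ht
      obtain ⟨L, hL, hLA, hΨL⟩ := ih (by omega)
      obtain ⟨a, haA, ha⟩ := hcon L (by omega) hLA
      refine ⟨a :: L, by simp [hL], by simpa [haA] using hLA, ?_⟩
      have : Ψ (a :: L) ≤ Ψ L + δ - ∑ x, ∑ z, p x z *
          ((a x z).toNat - 𝔼 w : J → R, ((a x (leader G L x w)).toNat : ℝ)) := by
        have hδs : δ = ∑ x, ∑ z, p x z * δ := by simp only [← Finset.sum_mul, hp1, one_mul]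
        rw [hδs]
        simp only [Ψ]
        rw [← Finset.sum_add_distrib, ← Finset.sum_sub_distrib]
        refine Finset.sum_le_sum fun x _ => ?_
        rw [← Finset.sum_add_distrib, ← Finset.sum_sub_distrib]
        refine Finset.sum_le_sum fun z _ => ?_
        rw [← mul_add, ← mul_sub]
        refine mul_le_mul_of_nonneg_left ?_ (hp x z)
        have := hG.leaderValue_add_le h0.le h1 (hits L x) (a x)
        rw [hits_cons]
        simp only [leader]
        push_cast
        linarith
      push_cast
      linarith
  -- Lists of length up to `T` can all be extended, and `T + 1` decrements of `δ` exceed the initial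
  -- potential, which is at most `T * δ`.
  obtain ⟨L, -, -, hL⟩ := step (T + 1) le_rfl
  have hδpos : 0 < δ := lt_of_lt_of_le (by
    have := pow_nonneg (show 0 ≤ 1 - η by linarith) M
    positivity) hδ
  have := hΨ0 L
  push_cast at hL
  linarith
end

/-! ### Gate counting for families of Boolean functions -/

/-- `Builds F k F'`: starting from the Boolean functions in `F`, adding `k` gates yields `F'`. -/
inductive Builds {D : Type} (F : Set (D → Bool)) : ℕ → Set (D → Bool) → Prop
  | refl : Builds F 0 F
  | gate {k : ℕ} {F' : Set (D → Bool)} (h : Builds F k F') (g : Gate F') :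
      Builds F (k + 1) (insert (fun d => g.eval fun w => w.1 d) F')

/-- The gate with its wires renamed. -/
def Gate.map {V W : Type} (f : V → W) : Gate V → Gate W
  | .const b => .const b
  | .not i => .not (f i)
  | .and i j => .and (f i) (f j)
  | .or i j => .or (f i) (f j)

theorem Gate.eval_map {V W : Type} (f : V → W) (g : Gate V) (v : W → Bool) :
    (g.map f).eval v = g.eval fun i => v (f i) := by
  cases g <;> rfl

section
variable {D : Type} {F F' F₂ G H : Set (D → Bool)} {k m : ℕ}

theorem Builds.subset (h : Builds F k F') : F ⊆ F' := by
  induction h with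
  | refl => exact subset_rfl
  | gate _ g ih => exact ih.trans (Set.subset_insert _ _)

theorem Builds.mono (h : Builds F k F') (hF : F ⊆ F₂) : ∃ F₂', Builds F₂ k F₂' ∧ F' ⊆ F₂' := by
  induction h with
  | refl => exact ⟨F₂, .refl, hF⟩
  | gate _ g ih =>
    obtain ⟨F₂', h₂, hs⟩ := ih
    refine ⟨_, h₂.gate (g.map (Set.inclusion hs)), ?_⟩
    simp only [Gate.eval_map]
    exact Set.insert_subset_insert hs

theorem Builds.trans (h : Builds F k F') (h' : Builds F' m F₂) : Builds F (k + m) F₂ := by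
  induction h' with
  | refl => exact h
  | gate _ g ih => exact ih.gate g

/-- All functions in `G` can be computed from those in `F` with `k` gates. -/
def Computes (F : Set (D → Bool)) (k : ℕ) (G : Set (D → Bool)) : Prop :=
  ∃ j F', j ≤ k ∧ Builds F j F' ∧ G ⊆ F'

theorem Computes.of_subset (h : G ⊆ F) : Computes F k G := ⟨0, F, k.zero_le, .refl, h⟩

theorem Computes.mono (h : Computes F k G) (hF : F ⊆ F₂) (hk : k ≤ m) (hG : H ⊆ G) :
    Computes F₂ m H := by
  obtain ⟨j, F', hj, hb, hG'⟩ := h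
  obtain ⟨F₂', hb', hs⟩ := hb.mono hF
  exact ⟨j, F₂', hj.trans hk, hb', (hG.trans hG').trans hs⟩

/-- Functions already computed are shared at no further cost, so only the new gates add up. -/
theorem Computes.trans (h : Computes F k G) (h' : Computes (F ∪ G) m H) :
    Computes F (k + m) (G ∪ H) := by
  obtain ⟨j, F', hj, hb, hG⟩ := h
  obtain ⟨j', F'', hj', hb', hH⟩ := h'
  obtain ⟨F₃, hb₃, hs⟩ := hb'.mono (Set.union_subset hb.subset hG)
  exact ⟨j + j', F₃, by omega, hb.trans hb₃,
    Set.union_subset (hG.trans hb₃.subset) (hH.trans hs)⟩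

theorem Computes.union (h : Computes F k G) (h' : Computes F m H) : Computes F (k + m) (G ∪ H) :=
  h.trans (h'.mono Set.subset_union_left le_rfl subset_rfl)

theorem Computes.biUnion {I : Type*} (s : Finset I) (Gs : I → Set (D → Bool))
    (h : ∀ i ∈ s, Computes F k (Gs i)) : Computes F (s.card * k) (⋃ i ∈ s, Gs i) := by
  classical
  induction s using Finset.induction_on with
  | empty => exact .of_subset (by simp)
  | insert a s ha ih =>
    have h1 := (h a (by simp)).union (ih fun i hi => h i (by simp [hi]))
    refine h1.mono subset_rfl (by rw [Finset.card_insert_of_notMem ha]; exact le_of_eq (by ring)) ?_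
    simp

theorem Computes.range {I : Type*} [Fintype I] (f : I → D → Bool)
    (h : ∀ i, Computes F k {f i}) : Computes F (Fintype.card I * k) (Set.range f) := by
  refine (Computes.biUnion Finset.univ (fun i => {f i}) fun i _ => h i).mono subset_rfl le_rfl ?_
  rintro _ ⟨i, rfl⟩
  simp

theorem Computes.gate (g : Gate F) : Computes F 1 {fun d => g.eval fun w => w.1 d} :=
  ⟨1, _, le_rfl, Builds.refl.gate g, by simp⟩

theorem Computes.const (b : Bool) : Computes F 1 {fun _ => b} := .gate (.const b)

theorem Computes.not {f : D → Bool} (hf : f ∈ F) : Computes F 1 {fun d => !f d} :=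
  .gate (.not ⟨f, hf⟩)

theorem Computes.and {f g : D → Bool} (hf : f ∈ F) (hg : g ∈ F) :
    Computes F 1 {fun d => f d && g d} :=
  .gate (.and ⟨f, hf⟩ ⟨g, hg⟩)

theorem Computes.or {f g : D → Bool} (hf : f ∈ F) (hg : g ∈ F) :
    Computes F 1 {fun d => f d || g d} :=
  .gate (.or ⟨f, hf⟩ ⟨g, hg⟩)

theorem Computes.comp {f : D → Bool} (h : Computes F k G) (h' : Computes (F ∪ G) m {f}) :
    Computes F (k + m) {f} :=
  (h.trans h').mono subset_rfl le_rfl Set.subset_union_right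

theorem Computes.forall_mem {I : Type*} (s : Finset I) (f : I → D → Bool) (h : ∀ i ∈ s, f i ∈ F) :
    Computes F (s.card + 1) {fun d => decide (∀ i ∈ s, f i d = true)} := by
  classical
  induction s using Finset.induction_on with
  | empty => simpa using Computes.const true
  | insert a s ha ih =>
    rw [Finset.card_insert_of_notMem ha]
    refine ((ih fun i hi => h i (by simp [hi])).comp
      (.and (f := f a) (.inl (h a (by simp))) (.inr rfl))).mono subset_rfl le_rfl ?_
    rw [Set.singleton_subset_singleton]
    ext d
    simp [Bool.decide_and]

theorem Computes.exists_mem {I : Type*} (s : Finset I) (f : I → D → Bool) (h : ∀ i ∈ s, f i ∈ F) :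
    Computes F (s.card + 1) {fun d => decide (∃ i ∈ s, f i d = true)} := by
  classical
  induction s using Finset.induction_on with
  | empty => simpa using Computes.const false
  | insert a s ha ih =>
    rw [Finset.card_insert_of_notMem ha]
    refine ((ih fun i hi => h i (by simp [hi])).comp
      (.or (f := f a) (.inl (h a (by simp))) (.inr rfl))).mono subset_rfl le_rfl ?_
    rw [Set.singleton_subset_singleton]
    ext d
    simp [Bool.decide_or]

theorem Netlist.eval_inl {ι : Type} (x : ι → Bool) {k : ℕ} (c : Netlist ι k) (i : ι) :
    c.eval x (Sum.inl i) = x i := by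
  cases c <;> rfl

theorem Netlist.eval_snoc_castSucc {ι : Type} (x : ι → Bool) {k : ℕ} (c : Netlist ι k)
    (g : Gate (ι ⊕ Fin k)) (w : ι ⊕ Fin k) :
    (Netlist.snoc c g).eval x (w.map id Fin.castSucc) = c.eval x w := by
  cases w with
  | inl i => rw [Sum.map_inl, Netlist.eval_inl, Netlist.eval_inl]; rfl
  | inr i => simp [Netlist.eval]

theorem Netlist.eval_snoc_last {ι : Type} (x : ι → Bool) {k : ℕ} (c : Netlist ι k)
    (g : Gate (ι ⊕ Fin k)) :
    (Netlist.snoc c g).eval x (Sum.inr (Fin.last k)) = g.eval (c.eval x) := by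
  simp [Netlist.eval]

theorem Computes.netlist {ι : Type} {k : ℕ} (c : Netlist ι k) (φ : ι → D → Bool)
    (hφ : ∀ i, φ i ∈ F) : Computes F k (Set.range fun w d => c.eval (fun i => φ i d) w) := by
  induction c with
  | nil =>
    refine .of_subset ?_
    rintro _ ⟨i | i, rfl⟩
    · exact hφ i
    · exact i.elim0
  | @snoc k c g ih =>
    have h2 := ih.trans (Computes.gate (F := F ∪ Set.range fun w d => c.eval (fun i => φ i d) w)
      (g.map fun w => ⟨fun d => c.eval (fun i => φ i d) w, Or.inr ⟨w, rfl⟩⟩))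
    refine h2.mono subset_rfl le_rfl ?_
    rintro _ ⟨w, rfl⟩
    have hcases : (∃ v : ι ⊕ Fin k, w = v.map id Fin.castSucc) ∨ w = Sum.inr (Fin.last k) := by
      rcases w with i | i
      · exact .inl ⟨.inl i, rfl⟩
      · induction i using Fin.lastCases with
        | last => exact .inr rfl
        | cast i => exact .inl ⟨.inr i, rfl⟩
    rcases hcases with ⟨v, rfl⟩ | rfl
    · exact .inl ⟨v, by simp only [Netlist.eval_snoc_castSucc]⟩
    · right
      simp only [Netlist.eval_snoc_last, Gate.eval_map, Set.mem_singleton_iff]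

theorem Builds.exists_netlist {ι : Type} {F' : Set ((ι → Bool) → Bool)}
    (h : Builds (Set.range fun i (x : ι → Bool) => x i) k F') :
    ∃ c : Netlist ι k, ∀ f ∈ F', ∃ w, ∀ x, c.eval x w = f x := by
  induction h with
  | refl =>
    refine ⟨.nil, ?_⟩
    rintro _ ⟨i, rfl⟩
    exact ⟨.inl i, fun x => rfl⟩
  | gate _ g ih =>
    obtain ⟨c, hc⟩ := ih
    choose w hw using hc
    refine ⟨.snoc c (g.map fun f => w f.1 f.2), ?_⟩
    rintro f (rfl | hf)
    · refine ⟨.inr (Fin.last _), fun x => ?_⟩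
      rw [Netlist.eval_snoc_last, Gate.eval_map]
      simp only [hw]
    · exact ⟨_, fun x => (Netlist.eval_snoc_castSucc x c _ _).trans (hw f hf x)⟩

theorem Computes.exists_circuit {ι κ : Type} {f : κ → (ι → Bool) → Bool}
    (h : Computes (Set.range fun i (x : ι → Bool) => x i) k (Set.range f)) :
    ∃ c : Circuit ι κ, c.size ≤ k ∧ ∀ x j, c.eval x j = f j x := by
  obtain ⟨j, F', hj, hb, hs⟩ := h
  obtain ⟨c, hc⟩ := hb.exists_netlist
  choose w hw using fun i => hc (f i) (hs ⟨i, rfl⟩)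
  exact ⟨⟨j, c, w⟩, hj, fun x i => hw i x⟩
end

/-! ### Geometric noise from coins -/

/-- The length (at most `M`) of the initial run of blocks of coins that are not all `true`. -/
def noise {M b : ℕ} (r : Fin M → Fin b → Bool) : ℕ :=
  Nat.findGreatest (fun k => ∀ i : Fin M, i.val < k → ¬ ∀ q, r i q = true) M

theorem le_noise_iff {M b : ℕ} (r : Fin M → Fin b → Bool) (k : ℕ) :
    k ≤ noise r ↔ k ≤ M ∧ ∀ i : Fin M, i.val < k → ¬ ∀ q, r i q = true := by
  constructor
  · intro h
    refine ⟨h.trans (Nat.findGreatest_le _), fun i hi => ?_⟩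
    exact Nat.findGreatest_spec
      (P := fun k => ∀ i : Fin M, i.val < k → ¬ ∀ q, r i q = true) (Nat.zero_le M)
      (fun i hi => absurd hi (Nat.not_lt_zero _)) i (lt_of_lt_of_le hi h)
  · rintro ⟨h, h'⟩
    exact Nat.le_findGreatest h h'

theorem isGeometric_noise (M b : ℕ) :
    IsGeometric (noise (M := M) (b := b)) ((1 / 2) ^ b) M := by
  refine ⟨fun r => Nat.findGreatest_le _, fun k hk => ?_⟩
  -- The tail event asks that none of the first `k` independent blocks be all `true`, so its
  -- indicator is a product over blocks.
  let f : Fin M → (Fin b → Bool) → ℝ := fun i q =>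
    if i.val < k then (if q = fun _ => true then 0 else 1) else 1
  have h1 : ∀ r : Fin M → Fin b → Bool, (if k ≤ noise r then (1 : ℝ) else 0) = ∏ i, f i (r i) := by
    intro r
    by_cases h : k ≤ noise r
    · rw [if_pos h]
      rw [le_noise_iff] at h
      symm
      refine Finset.prod_eq_one fun i _ => ?_
      simp only [f]
      split_ifs with h2 h3
      · exact absurd (fun q => congrFun h3 q) (h.2 i h2)
      · rfl
      · rfl
    · rw [if_neg h]
      rw [le_noise_iff] at h
      push Not at h
      obtain ⟨i, hi, hq⟩ := h hk
      symm
      refine Finset.prod_eq_zero (Finset.mem_univ i) ?_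
      simp only [f, if_pos hi]
      exact if_pos (funext hq)
  have h2 : ∀ i, (∑ q, f i q) = (2 : ℝ) ^ b * (if i.val < k then 1 - (1 / 2) ^ b else 1) := by
    intro i
    simp only [f]
    split_ifs with h
    · have : ∀ q : Fin b → Bool, (if q = fun _ => true then (0 : ℝ) else 1)
          = 1 - if q = fun _ => true then 1 else 0 := fun q => by split_ifs <;> norm_num
      simp only [this, Finset.sum_sub_distrib]
      simp [mul_sub]
    · simp
  simp only [h1]
  rw [Fintype.expect_eq_sum_div_card, ← Fintype.piFinset_univ, ← Finset.prod_univ_sum]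
  simp only [h2, Finset.prod_mul_distrib]
  rw [Finset.prod_ite]
  have h3 : (Finset.univ.filter fun i : Fin M => i.val < k).card = k := by
    rw [Fin.card_filter_val_lt]; omega
  simp [h3]

/-! ### A circuit for the perturbed leader -/

section
variable {D : Type} {F : Set (D → Bool)} {N M b n K : ℕ}

/-- Numbers are carried in unary, as the bits `k ≤ value` for `k ≤ K`. `K` may exceed `M` to leave
room for the scores; the bits beyond `M` are constantly false. -/
theorem computes_noise (w : D → Fin N → Fin M → Fin b → Bool)
    (hw : ∀ z i q, (fun d => w d z i q) ∈ F) (K : ℕ) :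
    Computes F (N * M * (b + 2) + N * (K + 1) * (M + 1))
      (Set.range fun (p : Fin N × Fin (K + 1)) d => decide (p.2.val ≤ noise (w d p.1))) := by
  have h1 : Computes F (N * M * (b + 2))
      (Set.range fun (p : Fin N × Fin M) d => !decide (∀ q, w d p.1 p.2 q = true)) := by
    refine (Computes.range _ fun p => ?_).mono (k := Fintype.card (Fin N × Fin M) * (b + 2))
      subset_rfl (by simp) subset_rfl
    refine ((Computes.forall_mem Finset.univ (fun q d => w d p.1 p.2 q) fun q _ => hw _ _ _).comp
      (.not (.inr rfl))).mono subset_rfl (by simp) ?_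
    simp
  refine (h1.trans (.range (k := M + 1) _ fun p => ?_)).mono subset_rfl (by simp)
    Set.subset_union_right
  by_cases hp : p.2.val ≤ M
  · refine (Computes.forall_mem (Finset.univ.filter fun i : Fin M => i.val < p.2.val)
      (fun i d => !decide (∀ q, w d p.1 i q = true)) fun i _ => .inr ⟨(p.1, i), rfl⟩).mono
      subset_rfl (by rw [Fin.card_filter_val_lt]; omega) ?_
    rw [Set.singleton_subset_singleton]
    ext d
    simp only [le_noise_iff, hp, true_and]
    simp
  · refine (Computes.const false).mono subset_rfl (by omega) ?_
    rw [Set.singleton_subset_singleton]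
    ext d
    simp [le_noise_iff, hp]

/-- Unary increment: bit `k + 1` becomes (old bit `k + 1`) or (test and old bit `k`), two gates per
bit. Bit `0` is always true and is reused. -/
theorem Computes.threshold {α : Type*} {c k : ℕ} (x : D → α) (g : D → Fin N → ℕ)
    (h0 : Computes F k (Set.range fun (p : Fin N × Fin (K + 1)) d => decide (p.2.val ≤ g d p.1)))
    (L : List (α → Fin N → Bool)) (hL : ∀ a ∈ L, ∀ z, Computes F c {fun d => a (x d) z}) :
    Computes F (k + L.length * (N * c + N * (K + 1) * 2))
      (Set.range fun (p : Fin N × Fin (K + 1)) d =>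
        decide (p.2.val ≤ g d p.1 + hits L (x d) p.1)) := by
  induction L with
  | nil => simpa [hits] using h0
  | cons a L ih =>
    have h1 := ih fun a' ha' => hL a' (by simp [ha'])
    have h2 : Computes (F ∪ Set.range fun (p : Fin N × Fin (K + 1)) d =>
        decide (p.2.val ≤ g d p.1 + hits L (x d) p.1)) (N * c)
        (Set.range fun z d => a (x d) z) := by
      refine (Computes.range _ fun z => ?_).mono (k := Fintype.card (Fin N) * c)
        subset_rfl (by simp) subset_rfl
      exact (hL a (by simp) z).mono Set.subset_union_left le_rfl subset_rfl
    refine ((h1.trans h2).trans (.range (k := 2) _ fun p => ?_)).mono subset_rfl ?_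
      Set.subset_union_right
    · obtain ⟨z, ⟨k, hk⟩⟩ := p
      cases k with
      | zero => exact .of_subset (by
          rw [Set.singleton_subset_iff]
          exact .inr (.inl ⟨(z, ⟨0, hk⟩), by ext; simp⟩))
      | succ k =>
        refine ((Computes.and (f := fun d => a (x d) z)
          (g := fun d => decide (k ≤ g d z + hits L (x d) z)) ?_ ?_).comp
          (.or (f := fun d => decide (k + 1 ≤ g d z + hits L (x d) z)) ?_
            (.inr rfl))).mono subset_rfl le_rfl ?_
        · exact .inr (.inr ⟨z, rfl⟩)
        · exact .inr (.inl ⟨(z, ⟨k, by omega⟩), rfl⟩)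
        · exact .inl (.inr (.inl ⟨(z, ⟨k + 1, hk⟩), rfl⟩))
        · rw [Set.singleton_subset_singleton]
          ext d
          rw [hits_cons]
          cases haz : a (x d) z
          · simp [haz]
          · rw [Bool.eq_iff_iff]
            simp [haz]
            omega
    · simp only [List.length_cons, Fintype.card_prod, Fintype.card_fin]
      exact le_of_eq (by ring)

/-- A value is maximal iff it reaches every threshold that some value reaches (`top`, `imp`, `mx`).
It is the first maximum iff moreover no earlier one is maximal (`low`). Each output bit is the
disjunction of `fst z` over the `z` whose code has that bit set. -/
theorem computes_firstMax [NeZero N] {κ : Type} [Fintype κ] (g : D → Fin N → ℕ)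
    (hg : ∀ d z, g d z ≤ K)
    (h : ∀ (z : Fin N) (k : Fin (K + 1)), (fun d => decide (k.val ≤ g d z)) ∈ F)
    (e : Fin N → κ → Bool) :
    Computes F ((K + 1) * (N + 1) + N * (K + 1) * 2 + N * (K + 2) + N + N * (N + 2)
        + Fintype.card κ * (N + 1))
      (Set.range fun j d => e (firstMax (g d)) j) := by
  let top : Fin (K + 1) → D → Bool := fun k d =>
    decide (∃ z ∈ Finset.univ, decide (k.val ≤ g d z) = true)
  let imp : Fin N × Fin (K + 1) → D → Bool := fun p d => !top p.2 d || decide (p.2.val ≤ g d p.1)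
  let mx : Fin N → D → Bool := fun z d => decide (∀ k ∈ Finset.univ, imp (z, k) d = true)
  let nmx : Fin N → D → Bool := fun z d => !mx z d
  let low : Fin N → D → Bool := fun z d =>
    decide (∀ y ∈ Finset.univ.filter (fun y => y < z), nmx y d = true)
  let fst : Fin N → D → Bool := fun z d => mx z d && low z d
  have hmx : ∀ z d, mx z d = true ↔ ∀ y, g d y ≤ g d z := by
    intro z d
    simp only [mx, imp, top, Finset.mem_univ, true_and, true_imp_iff, decide_eq_true_eq,
      Bool.or_eq_true, Bool.not_eq_true', decide_eq_false_iff_not]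
    constructor
    · intro h y
      rcases h ⟨g d y, by have := hg d y; omega⟩ with h | h
      · exact absurd ⟨y, le_rfl⟩ h
      · exact h
    · intro h k
      by_cases hk : ∃ y, k.val ≤ g d y
      · obtain ⟨y, hy⟩ := hk
        exact .inr (hy.trans (h y))
      · exact .inl hk
  have hfst : ∀ z d, fst z d = true ↔ firstMax (g d) = z := by
    intro z d
    rw [firstMax_eq_iff]
    simp only [fst, low, nmx, Bool.and_eq_true, decide_eq_true_eq, hmx, Finset.mem_filter,
      Finset.mem_univ, true_and, Bool.not_eq_true', ← Bool.not_eq_true]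
    constructor
    · rintro ⟨h1, h2⟩ y
      refine ⟨h1 y, fun hy => ?_⟩
      by_contra hlt
      exact h2 y hy fun y' => (h1 y').trans (not_lt.1 hlt)
    · intro h1
      exact ⟨fun y => (h1 y).1, fun y hy h2 => absurd ((h1 y).2 hy) (not_lt.2 (h2 z))⟩
  have s1 : Computes F ((K + 1) * (N + 1)) (Set.range top) := by
    refine (Computes.range (k := N + 1) _ fun k => ?_).mono subset_rfl (by simp) subset_rfl
    refine (Computes.exists_mem Finset.univ (fun z d => decide (k.val ≤ g d z))
      fun z _ => h z k).mono subset_rfl (by simp) (by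
        rw [Set.singleton_subset_singleton]; ext d; rw [Bool.eq_iff_iff]; simp [top])
  have s2 : Computes (F ∪ Set.range top) (N * (K + 1) * 2) (Set.range imp) := by
    refine (Computes.range (k := 2) _ fun p => ?_).mono subset_rfl (by simp) subset_rfl
    exact (Computes.not (f := top p.2) (.inr ⟨_, rfl⟩)).comp
      (.or (.inr rfl) (.inl (.inl (h p.1 p.2))))
  have s3 : Computes (F ∪ Set.range imp) (N * (K + 2)) (Set.range mx) := by
    refine (Computes.range (k := K + 2) _ fun z => ?_).mono subset_rfl (by simp) subset_rfl
    exact (Computes.forall_mem Finset.univ (fun k => imp (z, k))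
      fun k _ => .inr ⟨_, rfl⟩).mono subset_rfl (by simp) (by
        rw [Set.singleton_subset_singleton]; ext d; rw [Bool.eq_iff_iff]; simp [mx])
  have s4 : Computes (F ∪ Set.range mx) N (Set.range nmx) := by
    refine (Computes.range (k := 1) _ fun z => ?_).mono subset_rfl (by simp) subset_rfl
    exact Computes.not (.inr ⟨_, rfl⟩)
  have s5 : Computes (F ∪ Set.range mx ∪ Set.range nmx) (N * (N + 2)) (Set.range fst) := by
    refine (Computes.range (k := N + 2) _ fun z => ?_).mono subset_rfl (by simp) subset_rfl
    refine ((Computes.forall_mem (Finset.univ.filter (fun y => y < z)) nmx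
      fun y _ => .inr ⟨_, rfl⟩).comp
      (.and (f := mx z) (.inl (.inl (.inr ⟨_, rfl⟩))) (.inr rfl))).mono subset_rfl ?_ (by
        rw [Set.singleton_subset_singleton]; ext d; rw [Bool.eq_iff_iff]; simp [fst, low])
    have := Finset.card_le_univ (Finset.univ.filter (fun y => y < z))
    rw [Fintype.card_fin] at this
    omega
  have s6 : Computes (F ∪ Set.range fst) (Fintype.card κ * (N + 1))
      (Set.range fun j d => e (firstMax (g d)) j) := by
    refine (Computes.range (k := N + 1) _ fun j => ?_)
    refine (Computes.exists_mem (Finset.univ.filter fun z => e z j = true) fst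
      fun y _ => .inr ⟨_, rfl⟩).mono subset_rfl ?_ ?_
    · have := Finset.card_le_univ (Finset.univ.filter fun z => e z j = true)
      rw [Fintype.card_fin] at this
      omega
    · rw [Set.singleton_subset_singleton]
      ext d
      rw [Bool.eq_iff_iff]
      simp [hfst]
  have t1 := (s1.trans s2).mono subset_rfl le_rfl (Set.subset_union_right)
  have t2 := (t1.trans s3).mono subset_rfl le_rfl (Set.subset_union_right)
  have t3 := ((t2.trans s4).trans (s5.mono (by rw [Set.union_assoc]) le_rfl subset_rfl)).mono
    subset_rfl le_rfl (Set.subset_union_right)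
  exact (t3.trans s6).mono subset_rfl le_rfl (Set.subset_union_right)

/-- The gate count of the circuit that samples the perturbed leader of `T` tests of size `c`. -/
def leaderCost (N M b c l T : ℕ) : ℕ :=
  2 + (N * M * (b + 2) + N * (M + T + 1) * (M + 1)
    + T * (N * c + N * (M + T + 1) * 2)
    + ((M + T + 1) * (N + 1) + N * (M + T + 1) * 2 + N * (M + T + 2) + N + N * (N + 2)
        + l * (N + 1)))

/-- The tests computed (up to negation) by a wire of a circuit with at most `s` gates. -/
def circuitTests (n l s : ℕ) {J : Type*} (e : J → Fin l → Bool) : Set ((Fin n → Bool) → J → Bool) :=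
  {a | ∃ (k : ℕ) (c : Netlist (Fin n ⊕ Fin l) k) (v : (Fin n ⊕ Fin l) ⊕ Fin k) (neg : Bool), k ≤ s ∧
    ∀ x z, a x z = xor neg (c.eval (Sum.elim x (e z)) v)}

/-- The bits of `z` are hardwired as constants; the extra gate pays for a possible negation. -/
theorem computes_of_mem_circuitTests {n l s : ℕ} {J : Type*} {e : J → Fin l → Bool}
    {a : (Fin n → Bool) → J → Bool} (ha : a ∈ circuitTests n l s e) (x : D → Fin n → Bool)
    (hx : ∀ i, (fun d => x d i) ∈ F) (hc : ∀ β : Bool, (fun _ => β) ∈ F) (z : J) :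
    Computes F (s + 1) {fun d => a (x d) z} := by
  obtain ⟨k, c, v, neg, hk, hv⟩ := ha
  have h := Computes.netlist (F := F) c (Sum.elim (fun i d => x d i) fun j _ => e z j) (by
    rintro (i | j)
    · exact hx i
    · exact hc _)
  have hcv : ∀ d, c.eval (fun i => Sum.elim (fun i d => x d i) (fun j _ => e z j) i d) v
      = c.eval (Sum.elim (x d) (e z)) v := by
    intro d
    congr 1
    ext (i | j) <;> rfl
  cases neg
  · refine h.mono subset_rfl (by omega) ?_
    rw [Set.singleton_subset_iff]
    exact ⟨v, by ext d; simp only [hcv, hv, Bool.false_xor]⟩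
  · refine (h.comp (.not (.inr ⟨v, rfl⟩))).mono subset_rfl (by omega) ?_
    rw [Set.singleton_subset_singleton]
    ext d
    simp only [hcv, hv, Bool.true_xor]

theorem computes_leader [NeZero N] {l s T : ℕ} (e : Fin N → Fin l → Bool)
    (x : D → Fin n → Bool) (w : D → Fin N → Fin M → Fin b → Bool)
    (hx : ∀ i, (fun d => x d i) ∈ F) (hw : ∀ z i q, (fun d => w d z i q) ∈ F)
    (L : List ((Fin n → Bool) → Fin N → Bool)) (hL : ∀ a ∈ L, a ∈ circuitTests n l s e)
    (hT : L.length ≤ T) :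
    Computes F (leaderCost N M b (s + 1) l T)
      (Set.range fun j d => e (leader noise L (x d) (w d)) j) := by
  have h0 : Computes F 2 (Set.range fun (β : Bool) (_ : D) => β) :=
    (Computes.range (k := 1) _ fun β => .const β).mono subset_rfl (by simp) subset_rfl
  refine (h0.trans ?_).mono subset_rfl le_rfl Set.subset_union_right
  have h1 := (computes_noise (F := F ∪ Set.range fun (β : Bool) (_ : D) => β) w
    (fun z i q => .inl (hw z i q)) (M + T)).threshold (c := s + 1) x (fun d z => noise (w d z)) L
    fun a ha => computes_of_mem_circuitTests (hL a ha) x (fun i => .inl (hx i))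
      fun β => .inr ⟨β, rfl⟩
  have h2 := h1.trans (computes_firstMax (κ := Fin l) (K := M + T)
    (fun d => perturb noise (w d) (hits L (x d)))
    (fun d z => by
      have h3 : noise (w d z) ≤ M := Nat.findGreatest_le _
      have h4 : hits L (x d) z ≤ L.length := List.countP_le_length
      simp only [perturb]
      omega)
    (fun z k => .inr ⟨(z, k), rfl⟩) e)
  refine h2.mono subset_rfl ?_ Set.subset_union_right
  rw [Fintype.card_fin]
  have := Nat.mul_le_mul_right (N * (s + 1) + N * (M + T + 1) * 2) hT
  omega
end

theorem exists_leader_circuit {N M b n l s T : ℕ} [NeZero N] (e : Fin N → Fin l → Bool)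
    (L : List ((Fin n → Bool) → Fin N → Bool)) (hL : ∀ a ∈ L, a ∈ circuitTests n l s e)
    (hT : L.length ≤ T) :
    ∃ (r : ℕ) (ρ : (Fin r → Bool) ≃ (Fin N → Fin M → Fin b → Bool))
      (Sim : Circuit (Fin n ⊕ Fin r) (Fin l)), Sim.size ≤ leaderCost N M b (s + 1) l T ∧
      ∀ x u, Sim.eval (Sum.elim x u) = e (leader noise L x (ρ u)) := by
  let σ := Fintype.equivFin (Fin N × Fin M × Fin b)
  let ρ : (Fin (Fintype.card (Fin N × Fin M × Fin b)) → Bool) ≃ (Fin N → Fin M → Fin b → Bool) :=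
    { toFun := fun u z i q => u (σ (z, i, q))
      invFun := fun w t => w (σ.symm t).1 (σ.symm t).2.1 (σ.symm t).2.2
      left_inv := fun u => by ext t; simp
      right_inv := fun w => by ext z i q; simp }
  obtain ⟨Sim, hs, he⟩ := (computes_leader (M := M) (b := b)
    (F := Set.range fun i (d : Fin n ⊕ Fin (Fintype.card (Fin N × Fin M × Fin b)) → Bool) => d i)
    e (fun d i => d (.inl i)) (fun d => ρ fun t => d (.inr t))
    (fun i => ⟨.inl i, rfl⟩) (fun z i q => ⟨.inr (σ (z, i, q)), rfl⟩) L hL hT).exists_circuit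
  exact ⟨_, ρ, Sim, hs, fun x u => funext fun j => he _ j⟩

/-! ### Random coins and reduction to single wires -/

theorem integral_coins {r : ℕ} (f : (Fin r → Bool) → ℝ) : ∫ u, f u ∂(coins r) = 𝔼 u, f u := by
  rw [coins, PMF.integral_eq_sum, Fintype.expect_eq_sum_div_card, Finset.sum_div]
  refine Finset.sum_congr rfl fun u _ => ?_
  rw [PMF.uniformOfFintype_apply, smul_eq_mul, ENNReal.toReal_inv, ENNReal.toReal_natCast]
  ring

instance isProbabilityMeasure_coins (r : ℕ) : IsProbabilityMeasure (coins r) := by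
  unfold coins; infer_instance

/-- Fooling single wires up to `ε / 2` implies fooling circuits with values in `[0, 1]`. -/
theorem Indistinguishable.of_wires {ι : Type} [Finite ι] {s : ℕ} {ε : ℝ} {μ ν : Measure (ι → Bool)}
    [IsFiniteMeasure μ] [IsFiniteMeasure ν] (hε : 0 ≤ ε)
    (h : ∀ (k : ℕ) (c : Netlist ι k) (v : ι ⊕ Fin k), k ≤ s →
      |(∫ x, ((c.eval x v).toNat : ℝ) ∂μ) - ∫ x, ((c.eval x v).toNat : ℝ) ∂ν| ≤ ε / 2) :
    Indistinguishable s ε μ ν := by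
  intro p A hA _
  have h1 : ∀ μ : Measure (ι → Bool), IsFiniteMeasure μ → ∫ x, A.realEval x ∂μ
      = ∑ i : Fin p, (∫ x, ((A.gates.eval x (A.out i)).toNat : ℝ) ∂μ) / 2 ^ (i : ℕ) := by
    intro μ _
    simp only [Circuit.realEval]
    rw [integral_finsetSum _ fun i _ => .of_finite]
    refine Finset.sum_congr rfl fun i _ => ?_
    rw [integral_div]
    have hb : ∀ β : Bool, (if β = true then (1 : ℝ) else 0) = β.toNat := by
      rintro (_ | _) <;> simp
    exact congrArg (· / (2 : ℝ) ^ (i : ℕ)) (integral_congr_ae (.of_forall fun x => hb _))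
  rw [h1 μ ‹_›, h1 ν ‹_›, ← Finset.sum_sub_distrib]
  calc _ ≤ ∑ i : Fin p, ε / 2 * (1 / 2) ^ (i : ℕ) := by
        refine (Finset.abs_sum_le_sum_abs _ _).trans (Finset.sum_le_sum fun i _ => ?_)
        rw [← sub_div, abs_div, abs_of_pos (show (0 : ℝ) < 2 ^ (i : ℕ) by positivity), one_div,
          inv_pow, ← div_eq_mul_inv]
        gcongr
        exact h _ _ _ hA
    _ ≤ ε / 2 * 2 := by
        rw [← Finset.mul_sum, Fin.sum_univ_eq_sum_range (fun i => (1 / 2 : ℝ) ^ i)]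
        exact mul_le_mul_of_nonneg_left (sum_geometric_two_le p) (by positivity)
    _ = ε := by ring

/-! ### Parameters and size bounds -/

/-- The noise is truncated at `M = T`. Unary counters account for `N * T ^ 2`, evaluating every test
at every `z` for `N * T * s`, and selecting and encoding the leader for `N ^ 2`. -/
theorem leaderCost_le {N T b s l : ℕ} (hN : 1 ≤ N) (hT : 1 ≤ T) (hs : 1 ≤ s) (hb : b ≤ T)
    (hl : l ≤ N) :
    leaderCost N T b (s + 1) l T ≤ 34 * (N * T ^ 2) + 2 * (N * T * s) + 5 * N ^ 2 := by
  obtain ⟨N, rfl⟩ := Nat.exists_eq_add_of_le hN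
  obtain ⟨T, rfl⟩ := Nat.exists_eq_add_of_le hT
  obtain ⟨s, rfl⟩ := Nat.exists_eq_add_of_le hs
  have h1 : (1 + N) * (1 + T) * (b + 2) ≤ (1 + N) * (1 + T) * (1 + T + 2) := by gcongr
  have h2 : l * (1 + N + 1) ≤ (1 + N) * (1 + N + 1) := by gcongr
  unfold leaderCost
  have h3 : 2 + ((1 + N) * (1 + T) * (1 + T + 2) + (1 + N) * (1 + T + (1 + T) + 1) * (1 + T + 1)
    + (1 + T) * ((1 + N) * (1 + s + 1) + (1 + N) * (1 + T + (1 + T) + 1) * 2)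
    + ((1 + T + (1 + T) + 1) * ((1 + N) + 1) + (1 + N) * (1 + T + (1 + T) + 1) * 2 +
      (1 + N) * (1 + T + (1 + T) + 2) + (1 + N) + (1 + N) * ((1 + N) + 2)
        + (1 + N) * ((1 + N) + 1))) ≤
      34 * ((1 + N) * (1 + T) ^ 2) + 2 * ((1 + N) * (1 + T) * (1 + s)) + 5 * (1 + N) ^ 2 := by
    ring_nf
    nlinarith [Nat.zero_le (N * T), Nat.zero_le (N * T ^ 2), Nat.zero_le (N * T * s),
      Nat.zero_le (N * s), Nat.zero_le (T * s), Nat.zero_le (N ^ 2), Nat.zero_le (T ^ 2)]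
  omega

theorem succ_sq_le_four_mul_two_pow (l : ℕ) : (l + 1) ^ 2 ≤ 4 * 2 ^ l := by
  induction l using Nat.strong_induction_on with
  | _ l ih =>
    rcases lt_or_ge l 3 with h | h
    · interval_cases l <;> norm_num
    · obtain ⟨m, rfl⟩ := Nat.exists_eq_add_of_le h
      have := ih (2 + m) (by omega)
      rw [show 3 + m = (2 + m) + 1 by ring, pow_succ 2]
      nlinarith

theorem exists_parameters (l : ℕ) {ε : ℝ} (h0 : 0 < ε) (h1 : ε < 1) :
    ∃ b T k₀ : ℕ, 1 ≤ T ∧ b ≤ T ∧ (T : ℝ) ≤ 129 * (l + 1) / ε ^ 2 ∧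
      (1 / 2 : ℝ) ^ b + 2 ^ l * (1 - (1 / 2) ^ b) ^ T ≤ ε / 4 ∧
      k₀ + 2 ^ l * ((1 - (1 / 2) ^ b) ^ k₀ / (1 / 2) ^ b) < T * (ε / 4) := by
  -- Taking `b = m + 1` gives `ε / 16 ≤ η < ε / 8`, which leaves `ε / 8` of `δ = ε / 4` for the
  -- truncation error.
  obtain ⟨m, hm1, hm2⟩ := exists_nat_pow_near_of_lt_one (x := ε / 8) (y := (1 / 2 : ℝ))
    (by positivity) (by linarith) (by norm_num) (by norm_num)
  set η : ℝ := (1 / 2) ^ (m + 1) with hη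
  have hη0 : 0 < η := by positivity
  have hη1 : ε / 16 ≤ η := by rw [hη, pow_succ]; linarith
  have hηle : η ≤ 1 := by linarith
  have hl0 : (0 : ℝ) ≤ l := Nat.cast_nonneg l
  have hexp : ∀ k : ℕ, (2 : ℝ) ^ l * (1 - η) ^ k ≤ Real.exp (l - η * k) := by
    intro k
    have e1 : (2 : ℝ) ^ l ≤ Real.exp l := by
      rw [← Real.exp_one_pow]
      gcongr
      have := Real.add_one_le_exp (1 : ℝ)
      linarith
    have e2 : (1 - η) ^ k ≤ Real.exp (-(η * k)) := by
      rw [show -(η * k) = k * (-η) by ring, Real.exp_nat_mul]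
      exact pow_le_pow_left₀ (by linarith) (Real.one_sub_le_exp_neg η) k
    rw [sub_eq_add_neg (l : ℝ), Real.exp_add]
    exact mul_le_mul e1 e2 (pow_nonneg (by linarith) k) (Real.exp_pos _).le
  set τ : ℝ := 128 * (l + 1) / ε ^ 2 with hτ
  have hτ0 : 0 ≤ τ := by positivity
  have hTl : τ < ((⌊τ⌋₊ + 1 : ℕ) : ℝ) := by push_cast; exact Nat.lt_floor_add_one τ
  have hτε : τ * ε = 128 * (l + 1) / ε := by rw [hτ]; field_simp
  have hinv : 1 ≤ 1 / ε := by rw [le_div_iff₀ h0]; linarith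
  have hinv2 : 1 / ε ≤ 1 / ε ^ 2 := by
    rw [div_le_div_iff₀ h0 (by positivity)]; nlinarith
  -- `k₀` is where the union bound `2 ^ l * (1 - η) ^ k₀` falls to `1`. The initial potential is
  -- then at most `l / η + 1 + 1 / η ≤ τ * (ε / 4)`.
  refine ⟨m + 1, ⌊τ⌋₊ + 1, ⌈l / η⌉₊, by omega, ?_, ?_, ?_, ?_⟩
  · have e1 : ((m + 1 : ℕ) : ℝ) < 2 ^ (m + 1) := by exact_mod_cast Nat.lt_two_pow_self
    have e2 : (2 : ℝ) ^ (m + 1) = 1 / η := by rw [hη]; simp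
    have e3 : 1 / η ≤ 16 / ε := by
      rw [div_le_div_iff₀ hη0 h0]; linarith
    have e4 : 16 / ε ≤ τ := by
      have : 16 / ε = 16 * (1 / ε) := by ring
      have h' : τ = 128 * (l + 1) * (1 / ε ^ 2) := by rw [hτ]; ring
      rw [this, h']
      nlinarith
    have : ((m + 1 : ℕ) : ℝ) < ((⌊τ⌋₊ + 1 : ℕ) : ℝ) := by linarith
    exact (Nat.cast_lt.1 this).le
  · push_cast
    have := Nat.floor_le hτ0
    have h' : 129 * (l + 1) / ε ^ 2 = τ + (l + 1) * (1 / ε ^ 2) := by rw [hτ]; ring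
    rw [h']
    nlinarith
  · have e1 : (2 : ℝ) ^ l * (1 - η) ^ (⌊τ⌋₊ + 1) ≤ ε / 8 := by
      refine (hexp _).trans ?_
      have e2 : 8 * (l + 1) / ε ≤ η * ((⌊τ⌋₊ + 1 : ℕ) : ℝ) := by
        have : 8 * (l + 1) / ε = ε / 16 * τ := by
          rw [div_mul_eq_mul_div, mul_comm ε, hτε]; ring
        rw [this]
        gcongr
      have e3 : (l : ℝ) + 8 / ε ≤ 8 * (l + 1) / ε := by
        have : 8 * (l + 1) / ε = 8 * l * (1 / ε) + 8 / ε := by ring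
        rw [this]
        nlinarith
      have e4 : Real.exp (-(8 / ε)) ≤ ε / 8 := by
        have := Real.add_one_le_exp (8 / ε)
        rw [Real.exp_neg, ← inv_div 8 ε]
        have h8 : 0 < 8 / ε := by positivity
        exact inv_anti₀ h8 (by linarith)
      exact (Real.exp_le_exp.2 (by linarith)).trans e4
    linarith
  · have e1 : (2 : ℝ) ^ l * (1 - η) ^ ⌈l / η⌉₊ ≤ 1 := by
      refine (hexp _).trans (Real.exp_le_one_iff.2 ?_)
      have := Nat.le_ceil (l / η)
      rw [div_le_iff₀ hη0] at this
      linarith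
    have e2 : (⌈l / η⌉₊ : ℝ) < l / η + 1 := Nat.ceil_lt_add_one (by positivity)
    have e3 : (2 : ℝ) ^ l * ((1 - η) ^ ⌈l / η⌉₊ / η) ≤ 1 / η := by
      rw [← mul_div_assoc]
      gcongr
    have e4 : 1 ≤ 1 / η := by rw [le_div_iff₀ hη0]; linarith
    have e5 : 1 / η ≤ 16 * (1 / ε) := by
      rw [mul_one_div, div_le_div_iff₀ hη0 h0]; linarith
    have e6 : l / η + 1 + 1 / η ≤ 32 * (l + 1) / ε := by
      have a1 : l / η = l * (1 / η) := by ring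
      have a2 : 32 * (l + 1) / ε = 2 * (l + 1) * (16 * (1 / ε)) := by ring
      rw [a1, a2]
      nlinarith
    have e7 : 32 * (l + 1) / ε = τ * (ε / 4) := by rw [← mul_div_assoc, hτε]; ring
    have e8 : τ * (ε / 4) < ((⌊τ⌋₊ + 1 : ℕ) : ℝ) * (ε / 4) := by gcongr
    linarith

theorem cost_le {l s T : ℕ} {ε : ℝ} (h0 : 0 < ε) (h1 : ε < 1) (hs : 1 ≤ s)
    (hT : (T : ℝ) ≤ 129 * (l + 1) / ε ^ 2) :
    ((34 * (2 ^ l * T ^ 2) + 2 * (2 ^ l * T * s) + 5 * (2 ^ l) ^ 2 : ℕ) : ℝ)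
      ≤ 3000000 * (s * 2 ^ (2 * l) / ε ^ 4) := by
  have hs' : (1 : ℝ) ≤ s := by exact_mod_cast hs
  have hl0 : (0 : ℝ) ≤ l := Nat.cast_nonneg l
  have hq : ((l : ℝ) + 1) ^ 2 ≤ 4 * 2 ^ l := by exact_mod_cast succ_sq_le_four_mul_two_pow l
  have hq1 : (l : ℝ) + 1 ≤ 2 ^ l := by exact_mod_cast Nat.lt_two_pow_self
  set N : ℝ := 2 ^ l with hN
  have hN1 : 1 ≤ N := one_le_pow₀ (by norm_num)
  have hi2 : 1 ≤ 1 / ε ^ 2 := by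
    rw [le_div_iff₀ (by positivity)]; nlinarith
  set y : ℝ := 1 / ε ^ 2 with hy
  have hR : (3000000 * (s * 2 ^ (2 * l) / ε ^ 4) : ℝ) = 3000000 * (s * N ^ 2 * y ^ 2) := by
    rw [hN, hy, ← pow_mul, mul_comm l 2]; field_simp
  have hT' : (T : ℝ) ≤ 129 * (l + 1) * y := by rw [hy, mul_one_div]; exact hT
  have hT0 : (0 : ℝ) ≤ T := Nat.cast_nonneg T
  rw [hR]
  push_cast
  -- Here the `(l + 1) ^ 2` from `T ^ 2` is absorbed into the second factor `2 ^ l`.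
  have b1 : N * (T : ℝ) ^ 2 ≤ 66564 * (s * N ^ 2 * y ^ 2) := by
    calc N * (T : ℝ) ^ 2 ≤ N * (129 * (l + 1) * y) ^ 2 := by gcongr
      _ = 16641 * (N * (l + 1) ^ 2 * y ^ 2) := by ring
      _ ≤ 16641 * (N * (4 * N) * y ^ 2) := by gcongr
      _ = 66564 * (1 * N ^ 2 * y ^ 2) := by ring
      _ ≤ _ := by gcongr
  have b2 : N * T * s ≤ 129 * (s * N ^ 2 * y ^ 2) := by
    calc N * T * s ≤ N * (129 * N * y) * s := by
          gcongr
          exact hT'.trans (by gcongr)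
      _ = 129 * (s * N ^ 2 * (y * 1)) := by ring
      _ ≤ 129 * (s * N ^ 2 * (y * y)) := by gcongr
      _ = _ := by ring
  have b3 : N ^ 2 ≤ s * N ^ 2 * y ^ 2 := by
    calc N ^ 2 = 1 * N ^ 2 * 1 ^ 2 := by ring
      _ ≤ _ := by gcongr
  have : 0 ≤ s * N ^ 2 * y ^ 2 := by positivity
  linarith

/-! ### Passing to finite sums, and the main theorem -/

theorem integral_eq_sum_measureReal {Ω α J : Type*} [MeasurableSpace Ω] (P : Measure Ω)
    [IsProbabilityMeasure P] [Fintype α] [MeasurableSpace α] [MeasurableSingletonClass α]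
    [Fintype J] [MeasurableSpace J] [MeasurableSingletonClass J]
    {X : Ω → α} {Z : Ω → J} (hX : Measurable X) (hZ : Measurable Z) (f : α → J → ℝ) :
    ∫ o, f (X o) (Z o) ∂P = ∑ x, ∑ z, (P.map fun o => (X o, Z o)).real {(x, z)} * f x z := by
  have hm : Measurable fun o => (X o, Z o) := hX.prodMk hZ
  have := Measure.isProbabilityMeasure_map (μ := P) hm.aemeasurable
  have h1 : ∫ o, f (X o) (Z o) ∂P = ∫ y, f y.1 y.2 ∂(P.map fun o => (X o, Z o)) :=
    (integral_map hm.aemeasurable (f := fun y : α × J => f y.1 y.2) .of_discrete).symm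
  rw [h1, integral_fintype .of_finite, Fintype.sum_prod_type]
  rfl

theorem Indistinguishable.of_one_le {ι : Type} [Finite ι] {s : ℕ} {ε : ℝ} {μ ν : Measure (ι → Bool)}
    [IsProbabilityMeasure μ] [IsProbabilityMeasure ν] (hε : 1 ≤ ε) : Indistinguishable s ε μ ν := by
  intro p A _ hA1
  have hA0 : ∀ x, 0 ≤ A.realEval x := fun x => Finset.sum_nonneg fun i _ => by
    split_ifs <;> positivity
  have h : ∀ μ : Measure (ι → Bool), IsProbabilityMeasure μ →
      0 ≤ ∫ x, A.realEval x ∂μ ∧ ∫ x, A.realEval x ∂μ ≤ 1 := by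
    intro μ _
    refine ⟨integral_nonneg hA0, ?_⟩
    calc ∫ x, A.realEval x ∂μ ≤ ∫ _, (1 : ℝ) ∂μ := integral_mono .of_finite .of_finite hA1
      _ = 1 := by simp
  have h1 := h μ ‹_›
  have h2 := h ν ‹_›
  rw [abs_le]
  constructor <;> linarith

theorem measurable_sumElim {Ω ι κ : Type*} [MeasurableSpace Ω] {X : Ω → ι → Bool} {Z : Ω → κ → Bool}
    (hX : Measurable X) (hZ : Measurable Z) : Measurable fun o => Sum.elim (X o) (Z o) := by
  refine measurable_pi_iff.2 ?_
  rintro (i | j)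
  · exact (measurable_pi_apply i).comp hX
  · exact (measurable_pi_apply j).comp hZ

theorem measurable_simulated {Ω : Type*} [MeasurableSpace Ω] {n r l : ℕ} {X : Ω → Fin n → Bool}
    (hX : Measurable X) (Sim : Circuit (Fin n ⊕ Fin r) (Fin l)) :
    Measurable fun q : Ω × (Fin r → Bool) => Sum.elim (X q.1) (Sim.eval (Sum.elim (X q.1) q.2)) :=
  measurable_sumElim (hX.comp measurable_fst) ((Measurable.of_discrete (f := Sim.eval)).comp
    (measurable_sumElim (hX.comp measurable_fst) measurable_snd))

theorem integral_simulated {Ω : Type*} [MeasurableSpace Ω] (P : Measure Ω)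
    [IsProbabilityMeasure P] {n r l : ℕ} {X : Ω → Fin n → Bool}
    (hX : Measurable X) (Sim : Circuit (Fin n ⊕ Fin r) (Fin l)) (f : (Fin n ⊕ Fin l → Bool) → ℝ) :
    ∫ y, f y ∂((P.prod (coins r)).map fun q => Sum.elim (X q.1) (Sim.eval (Sum.elim (X q.1) q.2)))
      = ∫ o, (𝔼 u, f (Sum.elim (X o) (Sim.eval (Sum.elim (X o) u)))) ∂P := by
  have hm := measurable_simulated hX Sim
  have := Measure.isProbabilityMeasure_map (μ := P.prod (coins r)) hm.aemeasurable
  have hint : Integrable f ((P.prod (coins r)).map fun q =>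
    Sum.elim (X q.1) (Sim.eval (Sum.elim (X q.1) q.2))) := .of_finite
  rw [integral_map hm.aemeasurable .of_discrete]
  refine (integral_prod _ (hint.comp_measurable hm)).trans ?_
  simp only [integral_coins, Function.comp_apply]

theorem mainTheorem3 :
    ∃ C : ℝ, 0 < C ∧
      ∀ (n l : ℕ) {Ω : Type*} [MeasurableSpace Ω] (P : Measure Ω) [IsProbabilityMeasure P]
        (X : Ω → Fin n → Bool) (Z : Ω → Fin l → Bool), Measurable X → Measurable Z →
      ∀ (s : ℕ) (ε : ℝ), 1 ≤ s → 0 < ε →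
      ∃ (r : ℕ) (Sim : Circuit (Fin n ⊕ Fin r) (Fin l)),
        (Sim.size : ℝ) ≤ C * ((s : ℝ) * 2 ^ (2 * l) / ε ^ 4) ∧
        Indistinguishable s ε
          (P.map fun ω => Sum.elim (X ω) (Z ω))
          ((P.prod (coins r)).map fun q => Sum.elim (X q.1) (Sim.eval (Sum.elim (X q.1) q.2))) := by
  refine ⟨3000000, by norm_num, ?_⟩
  intro n l Ω _ P _ X Z hX hZ s ε hs hε
  have hXZ := measurable_sumElim hX hZ
  have := Measure.isProbabilityMeasure_map (μ := P) hXZ.aemeasurable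
  have hSim : ∀ (r : ℕ) (Sim : Circuit (Fin n ⊕ Fin r) (Fin l)), IsProbabilityMeasure
      ((P.prod (coins r)).map fun q => Sum.elim (X q.1) (Sim.eval (Sum.elim (X q.1) q.2))) :=
    fun r Sim => Measure.isProbabilityMeasure_map (measurable_simulated hX Sim).aemeasurable
  rcases le_or_gt 1 ε with h1 | h1
  -- For `1 ≤ ε` any simulator works; this one outputs its coins without gates.
  · refine ⟨l, ⟨0, .nil, fun j => .inl (.inr j)⟩, ?_, ?_⟩
    · simp only [Nat.cast_zero]; positivity
    · have := hSim l ⟨0, .nil, fun j => .inl (.inr j)⟩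
      exact .of_one_le h1
  obtain ⟨b, T, k₀, hT1, hbT, hT, hp1, hp2⟩ := exists_parameters l hε h1
  have hcard : Fintype.card (Fin l → Bool) = 2 ^ l := by simp
  let e : Fin (2 ^ l) ≃ (Fin l → Bool) := (Fintype.equivFinOfCardEq hcard).symm
  have hZ' : Measurable fun o => e.symm (Z o) := (Measurable.of_discrete (f := e.symm)).comp hZ
  let p : (Fin n → Bool) → Fin (2 ^ l) → ℝ := fun x z =>
    (P.map fun o => (X o, e.symm (Z o))).real {(x, z)}
  have hint : ∀ f : (Fin n → Bool) → Fin (2 ^ l) → ℝ,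
      ∫ o, f (X o) (e.symm (Z o)) ∂P = ∑ x, ∑ z, p x z * f x z :=
    integral_eq_sum_measureReal P hX hZ'
  have hpsum : ∑ x, ∑ z, p x z = 1 := by
    have := hint fun _ _ => 1
    simpa using this.symm
  -- The choice `δ = ε / 4` makes the one-sided advantage `2δ = ε / 2`, as needed for single wires.
  obtain ⟨L, hLT, hLmem, hL⟩ := (isGeometric_noise T b).exists_list (J := Fin (2 ^ l))
    (by positivity) (pow_le_one₀ (by norm_num) (by norm_num)) p (fun x z => measureReal_nonneg)
    hpsum (circuitTests n l s e) (ε / 4) k₀ T (by simpa using hp1) (by simpa using hp2)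
  obtain ⟨r, ρ, Sim, hsize, hsim⟩ := exists_leader_circuit (M := T) (b := b) e L hLmem hLT
  refine ⟨r, Sim, ?_, ?_⟩
  · refine le_trans ?_ (cost_le hε h1 hs hT)
    refine Nat.cast_le.2 (hsize.trans ?_)
    exact leaderCost_le Nat.one_le_two_pow hT1 hs hbT Nat.lt_two_pow_self.le
  · have := hSim r Sim
    refine .of_wires hε.le fun k c v hk => ?_
    rw [integral_map hXZ.aemeasurable .of_discrete, integral_simulated P hX Sim]
    -- The test and its negation are both in the class; applying `hL` to each bounds the absolute
    -- value.
    let a : Bool → (Fin n → Bool) → Fin (2 ^ l) → Bool := fun neg x z =>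
      xor neg (c.eval (Sum.elim x (e z)) v)
    have ha : ∀ neg, a neg ∈ circuitTests n l s e := fun neg => ⟨k, c, v, neg, hk, fun x z => rfl⟩
    let sim : (Fin n → Bool) → ℝ := fun x =>
      𝔼 w : Fin (2 ^ l) → Fin T → Fin b → Bool,
        ((a false x (leader noise L x w)).toNat : ℝ)
    have e1 : ∫ o, ((c.eval (Sum.elim (X o) (Z o)) v).toNat : ℝ) ∂P
        = ∑ x, ∑ z, p x z * ((a false x z).toNat : ℝ) := by
      rw [← hint fun x z => ((a false x z).toNat : ℝ)]
      simp [a]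
    have e2 : ∫ o, (𝔼 u, ((c.eval (Sum.elim (X o) (Sim.eval (Sum.elim (X o) u))) v).toNat : ℝ)) ∂P
        = ∑ x, ∑ z, p x z * sim x := by
      rw [← hint fun x _ => sim x]
      refine integral_congr_ae (.of_forall fun o => ?_)
      refine Fintype.expect_equiv ρ _ _ fun u => ?_
      simp only [hsim, a, Bool.false_xor]
    have e3 : ∀ x z, ((a true x z).toNat : ℝ) = 1 - (a false x z).toNat := by
      intro x z
      simp only [a, Bool.true_xor, Bool.false_xor]
      cases c.eval (Sum.elim x (e z)) v <;> simp
    have h₁ : ∑ x, ∑ z, p x z * ((a false x z).toNat - sim x) ≤ 2 * (ε / 4) := hL _ (ha false)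
    have h₂ := hL _ (ha true)
    simp only [e3, Finset.expect_sub_distrib, Fintype.expect_const] at h₂
    have h₃ : ∀ x z, p x z * (1 - ((a false x z).toNat : ℝ)
        - (1 - sim x)) = -(p x z * ((a false x z).toNat - sim x)) := fun x z => by ring
    rw [Finset.sum_congr rfl fun x _ => Finset.sum_congr rfl fun z _ => h₃ x z] at h₂
    simp only [Finset.sum_neg_distrib] at h₂
    rw [e1, e2, ← Finset.sum_sub_distrib]
    simp only [← Finset.sum_sub_distrib, ← mul_sub]
    rw [abs_le]
    constructor <;> linarith
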